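/- Let $N\ge 0$ and let $L_1,\dots,L_N\in\mathbb{C}$ be pairwise distinct numbers with $L_j\neq L_k^*$ for all $j,k$ (including $j=k$; in particular no $L_k$ is real), where $*$ is complex conjugation, applied entrywise to matrices. Let $f_{0k},\varphi_{0k}\in\mathbb{R}$ $(1\le k\le N)$ and let $\mathsf U$ be a constant unitary $2\times 2$ matrix. Put $\mu_k+i\nu_k=L_k/|L_k|^2$ with $\mu_k,\nu_k$ real, $$f_k(t,x)=\nu_kx+2\mu_k\nu_kt+f_{0k},\qquad \varphi_k(t,x)=-\mu_kx+(\nu_k^2-\mu_k^2)t+\varphi_{0k},$$ $$\mathsf L=\mathrm{diag}(L_1,\dots,L_N),\quad \mathsf C=\Bigl(\frac1{L_j-L_k^*}\Bigr)_{j,k},\quad \mathsf E=\mathrm{diag}\bigl(e^{f_k+i\varphi_k}\bigr)_k,\quad \mathsf Y=\mathsf C\mathsf E,\quad \mathsf\Omega=\mathsf Y(\mathsf 1+\mathsf Y^*\mathsf Y)^{-1},$$ $\langle\gamma|=\langle 1|(\mathsf C\mathsf L^*)^{-1}$, where $\langle 1|=(1,\dots,1)$ and $|1\rangle=(1,\dots,1)^T$.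 Then the matrices $\mathsf C\mathsf L^*$ and, for all $t,x\in\mathbb R$, $\mathsf 1+\mathsf Y^*\mathsf Y$ are invertible, and the $N$-soliton vector $$\psi=\mathsf U\begin{pmatrix}\langle\gamma|\mathsf\Omega|1\rangle\\ 1+\langle\gamma|\mathsf\Omega\mathsf Y^*|1\rangle\end{pmatrix}:\mathbb R^2\to\mathbb C^2$$ is a $C^\infty$ function of $(t,x)\in\mathbb R^2$. It satisfies $\psi^\dagger\psi=1$ and $i\psi_t+\psi_{xx}+\lambda\psi=0$ on $\mathbb R^2$ with $\lambda=\operatorname{Im}(\psi^\dagger\psi_t)+\psi_x^\dagger\psi_x$, and it is at the same time a solution on $\mathbb R^2$ of the vector nonlinear Schrödinger equation with gradient nonlinearity $$i\psi_t+\psi_{xx}+2(\psi_x^\dagger\psi_x)\psi=0 .$$ -/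

import Mathlib

open scoped Matrix ContDiff

noncomputable section

namespace ConstrainedNLSE

/-- Entrywise complex conjugate `M^*` of a matrix (no transposition). -/
def conjM {m n : Type*} (M : Matrix m n ℂ) : Matrix m n ℂ :=
  M.map (starRingEnd ℂ)

/-- The matrix `C` with entries `1 / (L_j - L_k^*)`. -/
def matC {N : ℕ} (L : Fin N → ℂ) : Matrix (Fin N) (Fin N) ℂ :=
  Matrix.of fun j k => 1 / (L j - starRingEnd ℂ (L k))

/-- The constant row `⟨γ| = ⟨1| (C L^*)⁻¹`, where `L^*` is the diagonal matrix of the `L_k^*`. -/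
def rowGamma {N : ℕ} (L : Fin N → ℂ) : Fin N → ℂ :=
  (1 : Fin N → ℂ) ᵥ* (matC L * Matrix.diagonal fun k => starRingEnd ℂ (L k))⁻¹

/-- `μ + i ν = L / |L|²`: the real part. -/
def mu (l : ℂ) : ℝ := (l / ((‖l‖ ^ 2 : ℝ) : ℂ)).re

/-- `μ + i ν = L / |L|²`: the imaginary part. -/
def nu (l : ℂ) : ℝ := (l / ((‖l‖ ^ 2 : ℝ) : ℂ)).im

/-- `f(t,x) = ν x + 2 μ ν t + f₀`. -/
def phaseF (l : ℂ) (f₀ t x : ℝ) : ℝ := nu l * x + 2 * mu l * nu l * t + f₀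

/-- `φ(t,x) = -μ x + (ν² - μ²) t + φ₀`. -/
def phasePhi (l : ℂ) (φ₀ t x : ℝ) : ℝ := -mu l * x + (nu l ^ 2 - mu l ^ 2) * t + φ₀

/-- The diagonal matrix `E(t,x)` with entries `exp (f_k + i φ_k)`. -/
def matE {N : ℕ} (L : Fin N → ℂ) (f₀ φ₀ : Fin N → ℝ) (t x : ℝ) : Matrix (Fin N) (Fin N) ℂ :=
  Matrix.diagonal fun k =>
    Complex.exp ((phaseF (L k) (f₀ k) t x : ℂ) + Complex.I * (phasePhi (L k) (φ₀ k) t x : ℂ))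

/-- `Y = C E`. -/
def matY {N : ℕ} (L : Fin N → ℂ) (f₀ φ₀ : Fin N → ℝ) (t x : ℝ) : Matrix (Fin N) (Fin N) ℂ :=
  matC L * matE L f₀ φ₀ t x

/-- `Ω = Y (1 + Y^* Y)⁻¹`. -/
def matOmega {N : ℕ} (L : Fin N → ℂ) (f₀ φ₀ : Fin N → ℝ) (t x : ℝ) :
    Matrix (Fin N) (Fin N) ℂ :=
  matY L f₀ φ₀ t x * (1 + conjM (matY L f₀ φ₀ t x) * matY L f₀ φ₀ t x)⁻¹

/-- The `N`-soliton vector `ψ = U (⟨γ|Ω|1⟩, 1 + ⟨γ|Ω Y^*|1⟩)ᵀ`. -/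
def nSoliton {N : ℕ} (L : Fin N → ℂ) (f₀ φ₀ : Fin N → ℝ) (U : Matrix (Fin 2) (Fin 2) ℂ)
    (t x : ℝ) : Fin 2 → ℂ :=
  U *ᵥ ![(rowGamma L ᵥ* matOmega L f₀ φ₀ t x) ⬝ᵥ 1,
    1 + (rowGamma L ᵥ* (matOmega L f₀ φ₀ t x * conjM (matY L f₀ φ₀ t x))) ⬝ᵥ 1]

/-- `ψ_t`. -/
def dt (ψ : ℝ → ℝ → Fin 2 → ℂ) (t x : ℝ) : Fin 2 → ℂ := deriv (fun s => ψ s x) t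

/-- `ψ_x`. -/
def dx (ψ : ℝ → ℝ → Fin 2 → ℂ) (t x : ℝ) : Fin 2 → ℂ := deriv (fun y => ψ t y) x

/-- The multiplier `λ = Im (ψ† ψ_t) + ψ_x† ψ_x`, where the last term, being `|ψ_x|²`, is real. -/
def multiplier (ψ : ℝ → ℝ → Fin 2 → ℂ) (t x : ℝ) : ℝ :=
  (star (ψ t x) ⬝ᵥ dt ψ t x).im + (star (dx ψ t x) ⬝ᵥ dx ψ t x).re

/-- The constrained Schrödinger system `ψ† ψ = 1`, `i ψ_t + ψ_xx + λ ψ = 0`, with `λ` the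
multiplier above. As `λ` is real, the equation for `ψ†` is the conjugate of the one for `ψ`. -/
def SolvesConstrained (ψ : ℝ → ℝ → Fin 2 → ℂ) : Prop :=
  ∀ t x : ℝ, star (ψ t x) ⬝ᵥ ψ t x = 1 ∧
    Complex.I • dt ψ t x + dx (dx ψ) t x + (multiplier ψ t x : ℂ) • ψ t x = 0

/-- The vector NLSE with gradient nonlinearity, `i ψ_t + ψ_xx + 2 (ψ_x† ψ_x) ψ = 0`. -/
def SolvesGradientNLSE (ψ : ℝ → ℝ → Fin 2 → ℂ) : Prop :=
  ∀ t x : ℝ, Complex.I • dt ψ t x + dx (dx ψ) t x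
    + (2 * (star (dx ψ t x) ⬝ᵥ dx ψ t x)) • ψ t x = 0

end ConstrainedNLSE

end

/-! The soliton is a row of a dressing matrix. With `a = 1 / L^*`, the entries of `E` are `exp (-i a
x - i a² t)` up to constants. Let `T = [[1, -Y^*], [Y, 1]]`, `S = T⁻¹` and `A = diag (a, a^*)`, let
`V` consist of columns of ones, and let `K` carry the row `⟨γ|Y = (E_k a_k)` and minus its
conjugate. The Cauchy structure of `C` becomes the displacement equation `T A - A T = A V K`.

Put `W = 1 + K S V` and `H = K S A V`. As `T_x = (T - 1) P` and `K_x = K P` with `P = -i σ A`, where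
`σ` is the diagonal sign matrix (and `-i σ A²` replaces `P` for `t`), derivatives of `K S B` are `K
S P S B`. The displacement equation then gives `W_x = (i/2) [σ, H] W` and `W_t = H_x W`. It also
makes `T + V K` similar to `T`, so that `det W = 1`; with the symplectic symmetry of all blocks, `W`
lies in `SU(2)`.

Up to `U`, its second row is `ψ` and its first row a unit companion `φ` orthogonal to `ψ`. With `h =
H_21`: `ψ_x = -i h φ`, `φ_x = -i h^* ψ`, `ψ_t = h_x φ + i |h|² ψ`. Hence `i ψ_t + ψ_xx = -2 |h|² ψ`,
while `|ψ_x|² = |h|²` and `λ = 2 |h|²`, so both equations hold.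

Invertibility of `C` and `1 + Y^* Y` follows because a kernel vector stays in the kernel under the
diagonal matrix `L^*`, which a Vandermonde argument excludes unless the vector is zero
(`isUnit_of_ker_invariant`). -/

noncomputable section

namespace ConstrainedNLSE

open Matrix

/-! ### Nonsingularity of the Cauchy-type matrices. -/

section Invertibility

/-- A matrix whose kernel is invariant under a diagonal matrix with distinct entries, and
annihilated by a row without zero entries, is invertible. -/
theorem isUnit_of_ker_invariant {N : ℕ} {M : Matrix (Fin N) (Fin N) ℂ} {d e : Fin N → ℂ}
    (hd : Function.Injective d) (he : ∀ k, e k ≠ 0)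
    (h : ∀ v, M *ᵥ v = 0 → e ⬝ᵥ v = 0 ∧ M *ᵥ (fun k => d k * v k) = 0) : IsUnit M := by
  rw [← mulVec_injective_iff_isUnit]
  refine (injective_iff_map_eq_zero (Matrix.mulVecLin M)).2 fun v hv => ?_
  rw [mulVecLin_apply] at hv
  have key : ∀ n : ℕ, M *ᵥ (fun k => d k ^ n * v k) = 0 := by
    intro n
    induction n with
    | zero => simpa using hv
    | succ n ih =>
      have := (h _ ih).2
      simpa only [← mul_assoc, ← pow_succ'] using this
  -- All power sums `∑ d_k^n e_k v_k` vanish, and the nodes `d_k` are distinct: Vandermonde.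
  have hz : (fun k => e k * v k) = 0 := by
    refine eq_zero_of_forall_pow_sum_mul_pow_eq_zero hd fun i => ?_
    have := (h _ (key i)).1
    rw [dotProduct] at this
    rw [← this]
    exact Finset.sum_congr rfl fun k _ => by ring
  funext k
  have := congrFun hz k
  simpa [he k] using this

variable {N : ℕ} {L : Fin N → ℂ}

theorem matC_apply (L : Fin N → ℂ) (j k : Fin N) :
    matC L j k = 1 / (L j - starRingEnd ℂ (L k)) := rfl

theorem conjM_matC_apply (L : Fin N → ℂ) (j k : Fin N) :
    conjM (matC L) j k = - matC L k j := by
  rw [conjM, map_apply, matC_apply, matC_apply, map_div₀, map_sub, Complex.conj_conj, map_one,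
    ← neg_sub, div_neg]

theorem conj_matC_apply (L : Fin N → ℂ) (j k : Fin N) :
    starRingEnd ℂ (matC L j k) = - matC L k j := conjM_matC_apply L j k

theorem matC_displacement (hLc : ∀ j k, L j ≠ starRingEnd ℂ (L k)) (j k : Fin N) :
    matC L j k * starRingEnd ℂ (L k) = L j * matC L j k - 1 := by
  rw [matC_apply]
  have := sub_ne_zero.2 (hLc j k)
  field_simp
  ring

theorem ne_zero_of_ne_conj (hLc : ∀ j k, L j ≠ starRingEnd ℂ (L k)) (k : Fin N) : L k ≠ 0 := by
  intro h
  apply hLc k k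
  simp [h]

theorem conj_comp_injective (hL : Function.Injective L) :
    Function.Injective fun k => starRingEnd ℂ (L k) :=
  (starRingEnd ℂ).injective.comp hL

/-- `C` is skew-Hermitian, so `C v = 0` also gives `v† C = 0`. The displacement identity turns `C
L^* v` into the constant vector `-(1 ⬝ᵥ v)`, and pairing with `v†` leaves `|1 ⬝ᵥ v|² = 0`. -/
theorem isUnit_matC (hL : Function.Injective L) (hLc : ∀ j k, L j ≠ starRingEnd ℂ (L k)) :
    IsUnit (matC L) := by
  refine isUnit_of_ker_invariant (e := 1) (conj_comp_injective hL) (by simp) fun v hv => ?_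
  have hshift : matC L *ᵥ (fun k => starRingEnd ℂ (L k) * v k) = fun _ => -(1 ⬝ᵥ v) := by
    funext j
    have hj := congrFun hv j
    simp only [mulVec, dotProduct, Pi.zero_apply] at hj ⊢
    calc ∑ k, matC L j k * (starRingEnd ℂ (L k) * v k)
        = ∑ k, (L j * (matC L j k * v k) - 1 * v k) :=
          Finset.sum_congr rfl fun k _ => by rw [← mul_assoc, matC_displacement hLc]; ring
      _ = _ := by rw [Finset.sum_sub_distrib, ← Finset.mul_sum, hj]; simp
  have hleft : star v ᵥ* matC L = 0 := by
    funext k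
    have hk := congrArg (starRingEnd ℂ) (congrFun hv k)
    simp only [mulVec, vecMul, dotProduct, Pi.zero_apply, map_sum, map_mul, map_zero,
      conj_matC_apply] at hk ⊢
    rw [← neg_eq_zero, ← hk, ← Finset.sum_neg_distrib]
    exact Finset.sum_congr rfl fun j _ => by simp [mul_comm]
  have h0 : (1 : Fin N → ℂ) ⬝ᵥ v = 0 := by
    have : star v ⬝ᵥ (matC L *ᵥ (fun k => starRingEnd ℂ (L k) * v k)) = 0 := by
      rw [dotProduct_mulVec, hleft, zero_dotProduct]
    rw [hshift] at this
    simp only [dotProduct, Pi.star_apply, ← Finset.sum_mul, Pi.one_apply, one_mul] at this ⊢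
    have hs : ∑ i, star (v i) = star (∑ i, v i) := (star_sum _ _).symm
    rw [hs, mul_neg, neg_eq_zero, mul_eq_zero, star_eq_zero, or_self] at this
    exact this
  refine ⟨h0, ?_⟩
  rw [hshift, h0]
  funext; simp

theorem isUnit_matC_mul_diagonal (hL : Function.Injective L)
    (hLc : ∀ j k, L j ≠ starRingEnd ℂ (L k)) :
    IsUnit (matC L * Matrix.diagonal fun k => starRingEnd ℂ (L k)) := by
  refine (isUnit_matC hL hLc).mul ?_
  rw [isUnit_iff_isUnit_det, det_diagonal, isUnit_iff_ne_zero, Finset.prod_ne_zero_iff]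
  exact fun k _ => by simpa using ne_zero_of_ne_conj hLc k

theorem mul_conj_add_mul_conj_eq_zero {a b : ℂ}
    (h : a * starRingEnd ℂ a + b * starRingEnd ℂ b = 0) : b = 0 := by
  rw [Complex.mul_conj, Complex.mul_conj, ← Complex.ofReal_add, Complex.ofReal_eq_zero] at h
  have h1 := Complex.normSq_nonneg a
  have h2 := Complex.normSq_nonneg b
  exact Complex.normSq_eq_zero.1 (by linarith)

theorem isUnit_one_add_conj_mul_self (hL : Function.Injective L)
    (hLc : ∀ j k, L j ≠ starRingEnd ℂ (L k)) {e : Fin N → ℂ} (he : ∀ k, e k ≠ 0)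
    {Y : Matrix (Fin N) (Fin N) ℂ} (hY : Y = matC L * diagonal e) :
    IsUnit (1 + conjM Y * Y) := by
  have hYa : ∀ j k, Y j k = matC L j k * e k := fun j k => by rw [hY, mul_diagonal]
  have hYc : ∀ j k, conjM Y j k = - matC L k j * starRingEnd ℂ (e k) := fun j k => by
    rw [conjM, map_apply, hYa, map_mul, conj_matC_apply]
  refine isUnit_of_ker_invariant (conj_comp_injective hL) he fun v hv => ?_
  set u := Y *ᵥ v with hu
  have hYu : conjM Y *ᵥ u = -v := by
    rw [add_mulVec, one_mulVec, ← mulVec_mulVec, ← hu] at hv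
    exact eq_neg_of_add_eq_zero_right hv
  -- The left null vector belonging to `v`, again obtained from the skew-Hermitian symmetry of `C`.
  set r : Fin N → ℂ := fun k => starRingEnd ℂ (u k) * e k with hr
  have hrY : r ᵥ* conjM Y = fun k => starRingEnd ℂ (v k * e k) := by
    funext k
    have hk : starRingEnd ℂ ((conjM Y *ᵥ u) k) = - starRingEnd ℂ (v k) := by
      rw [hYu]; simp
    rw [map_mul, ← neg_neg (starRingEnd ℂ (v k)), ← hk]
    simp only [mulVec, vecMul, dotProduct, map_sum, map_mul, hr, hYc, ← Finset.sum_neg_distrib,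
      Finset.sum_mul, map_neg, conj_matC_apply, Complex.conj_conj]
    exact Finset.sum_congr rfl fun j _ => by ring
  have hrYY : r ᵥ* (1 + conjM Y * Y) = 0 := by
    rw [vecMul_add, vecMul_one, ← vecMul_vecMul, hrY]
    funext k
    simp only [Pi.add_apply, hr, Pi.zero_apply, hu]
    simp only [mulVec, vecMul, dotProduct, map_sum, map_mul, hYa, Finset.sum_mul,
      conj_matC_apply, ← Finset.sum_add_distrib]
    exact Finset.sum_eq_zero fun j _ => by ring
  have hsh : (1 + conjM Y * Y) *ᵥ (fun k => starRingEnd ℂ (L k) * v k) =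
      -(fun _ => starRingEnd ℂ (e ⬝ᵥ star u)) - (e ⬝ᵥ v) • (conjM Y *ᵥ 1) := by
    have h1 : Y *ᵥ (fun k => starRingEnd ℂ (L k) * v k) =
        (fun j => L j * u j) - (e ⬝ᵥ v) • (1 : Fin N → ℂ) := by
      funext j
      simp only [Pi.sub_apply, Pi.smul_apply, Pi.one_apply, smul_eq_mul, mul_one, hu, mulVec,
        dotProduct, Finset.mul_sum, ← Finset.sum_sub_distrib, hYa]
      exact Finset.sum_congr rfl fun k _ => by
        linear_combination (e k * v k) * matC_displacement hLc j k
    have h2 : conjM Y *ᵥ (fun k => L k * u k) =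
        (fun j => starRingEnd ℂ (L j) * (conjM Y *ᵥ u) j) -
          (fun _ => starRingEnd ℂ (e ⬝ᵥ star u)) := by
      funext j
      simp only [Pi.sub_apply, mulVec, dotProduct, Finset.mul_sum, map_sum,
        ← Finset.sum_sub_distrib, hYc, map_mul, Pi.star_apply]
      refine Finset.sum_congr rfl fun k _ => ?_
      have : starRingEnd ℂ (star (u k)) = u k := Complex.conj_conj _
      rw [this]
      linear_combination (starRingEnd ℂ (e k) * u k) * matC_displacement hLc k j
    rw [add_mulVec, one_mulVec, ← mulVec_mulVec, h1, mulVec_sub, h2, hYu, mulVec_smul]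
    funext j
    simp only [Pi.sub_apply, Pi.add_apply, Pi.neg_apply, Pi.smul_apply]
    ring
  -- Evaluated through `hsh`, this pairing is minus the sum of `|e ⬝ᵥ star u|²` and `|e ⬝ᵥ v|²`, so
  -- both rank-one defects vanish.
  have hz : r ⬝ᵥ ((1 + conjM Y * Y) *ᵥ (fun k => starRingEnd ℂ (L k) * v k)) = 0 := by
    rw [dotProduct_mulVec, hrYY, zero_dotProduct]
  have hr1 : ∀ c : ℂ, r ⬝ᵥ (fun _ => c) = (e ⬝ᵥ star u) * c := by
    intro c
    simp only [dotProduct, hr, Finset.sum_mul]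
    exact Finset.sum_congr rfl fun k _ => by
      rw [mul_comm (starRingEnd ℂ (u k))]; rfl
  have hr2 : r ⬝ᵥ (conjM Y *ᵥ 1) = starRingEnd ℂ (e ⬝ᵥ v) := by
    rw [dotProduct_mulVec, hrY]
    simp only [dotProduct, map_sum, Pi.one_apply, mul_one]
    exact Finset.sum_congr rfl fun k _ => by rw [mul_comm]
  rw [hsh, dotProduct_sub, dotProduct_neg, hr1, dotProduct_smul, hr2, smul_eq_mul] at hz
  have hab : (e ⬝ᵥ star u) * starRingEnd ℂ (e ⬝ᵥ star u) +
      (e ⬝ᵥ v) * starRingEnd ℂ (e ⬝ᵥ v) = 0 := by linear_combination -hz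
  have hv0 := mul_conj_add_mul_conj_eq_zero hab
  have hu0 := mul_conj_add_mul_conj_eq_zero ((add_comm _ _).trans hab)
  refine ⟨hv0, ?_⟩
  rw [hsh, hu0, hv0]
  funext; simp

end Invertibility

/-! ### Noncommutative algebra of the displacement equation. -/

section Dressing

variable {ι κ : Type*} [Fintype ι] [DecidableEq ι] [Fintype κ]
  {T S A sg : Matrix ι ι ℂ} {V : Matrix ι κ ℂ} {K : Matrix κ ι ℂ} {s : Matrix κ κ ℂ}

/-- The displacement equation for `T`, read as one for its inverse `S`. -/
theorem inverse_displacement (hTS : T * S = 1) (hST : S * T = 1)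
    (hD : T * A - A * T = A * V * K) : S * A * V * K * S = A * S - S * A := by
  have : S * (T * A - A * T) * S = S * (A * V * K) * S := by rw [hD]
  simp only [Matrix.mul_sub, Matrix.sub_mul, ← Matrix.mul_assoc, hST, Matrix.one_mul] at this
  rw [← this, Matrix.mul_assoc (S * A), hTS, Matrix.mul_one]

theorem inverse_anticomm (hTS : T * S = 1) (hsg : T * sg + sg * T = sg + sg) :
    T * sg * S = sg * S + sg * S - sg := by
  have : (T * sg + sg * T) * S = (sg + sg) * S := by rw [hsg]
  rw [Matrix.add_mul, Matrix.mul_assoc sg, hTS, Matrix.mul_one, Matrix.add_mul] at this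
  rw [← this]; abel

theorem moment_mul_dressing [DecidableEq κ] (hTS : T * S = 1) (hST : S * T = 1)
    (hD : T * A - A * T = A * V * K) :
    (K * S * A * V) * (1 + K * S * V) = K * A * S * V := by
  have h := inverse_displacement hTS hST hD
  have : (K * S * A * V) * (K * S * V) = K * (S * A * V * K * S) * V := by
    simp only [Matrix.mul_assoc]
  rw [Matrix.mul_add, Matrix.mul_one, this, h]
  simp only [Matrix.mul_sub, Matrix.sub_mul, Matrix.mul_assoc]
  abel

theorem dressing_time [DecidableEq κ] (hTS : T * S = 1) (hST : S * T = 1)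
    (hD : T * A - A * T = A * V * K) (P : Matrix ι ι ℂ) :
    (K * S * P * S * A * V) * (1 + K * S * V) = K * S * P * A * S * V := by
  have h := inverse_displacement hTS hST hD
  have : (K * S * P * S * A * V) * (K * S * V) = K * S * P * (S * A * V * K * S) * V := by
    simp only [Matrix.mul_assoc]
  rw [Matrix.mul_add, Matrix.mul_one, this, h]
  simp only [Matrix.mul_sub, Matrix.sub_mul, Matrix.mul_assoc]
  abel

/-- Moving `s` through `K` produces `S A V K = A - S A T`, after which `T sg S` is resolved by the
anticommutation relation. `B` is free because both `V` and `A * V` are needed. -/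
theorem moment_sign_mul (hTS : T * S = 1) (hST : S * T = 1)
    (hD : T * A - A * T = A * V * K) (hK : K * sg = -(s * K))
    (hsg : T * sg + sg * T = sg + sg) (B : Matrix ι κ ℂ) :
    (K * S * A * V) * s * (K * S * B) =
      -(K * A * sg * S * B) + (2 : ℂ) • (K * S * A * sg * S * B) - K * S * A * sg * B := by
  have h1 : S * A * V * K = A - S * A * T + (S * (A * V * K - (T * A - A * T))) := by
    simp only [Matrix.mul_sub, ← Matrix.mul_assoc, hST, Matrix.one_mul]
    abel
  rw [hD, sub_self, Matrix.mul_zero, add_zero] at h1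
  have h2 := inverse_anticomm hTS hsg
  calc (K * S * A * V) * s * (K * S * B) = (K * S * A * V) * (s * K) * S * B := by
        simp only [Matrix.mul_assoc]
    _ = -(K * (S * A * V * K) * sg * S * B) := by
        rw [← neg_neg (s * K), ← hK]
        simp only [Matrix.mul_neg, Matrix.neg_mul, Matrix.mul_assoc]
    _ = -(K * A * sg * S * B) + K * S * A * (T * sg * S) * B := by
        rw [h1]
        simp only [Matrix.mul_sub, Matrix.sub_mul, Matrix.mul_assoc]
        abel
    _ = _ := by
        rw [h2]
        simp only [Matrix.mul_sub, Matrix.sub_mul, Matrix.mul_add, Matrix.add_mul,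
          Matrix.mul_assoc, two_smul]
        abel

theorem commutator_mul_dressing [DecidableEq κ] (hTS : T * S = 1) (hST : S * T = 1)
    (hD : T * A - A * T = A * V * K) (hK : K * sg = -(s * K)) (hV : sg * V = V * s)
    (hsgA : sg * A = A * sg) (hsg : T * sg + sg * T = sg + sg) :
    (s * (K * S * A * V) - (K * S * A * V) * s) * (1 + K * S * V) =
      (-2 : ℂ) • (K * S * sg * A * S * V) := by
  have h1 : s * (K * S * A * V) * (1 + K * S * V) = -(K * sg * A * S * V) := by
    rw [Matrix.mul_assoc, moment_mul_dressing hTS hST hD, hK]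
    simp only [Matrix.neg_mul, neg_neg, Matrix.mul_assoc]
  have h2 := moment_sign_mul hTS hST hD hK hsg V
  have h3 : (K * S * A * V) * s = K * S * A * sg * V := by
    rw [Matrix.mul_assoc _ V, ← hV]
    simp only [Matrix.mul_assoc]
  have e1 : K * A * sg * S * V = K * sg * A * S * V := by
    rw [Matrix.mul_assoc K A, ← hsgA]; simp only [Matrix.mul_assoc]
  have e2 : K * S * A * sg * S * V = K * S * sg * A * S * V := by
    rw [Matrix.mul_assoc (K * S) A, ← hsgA]; simp only [Matrix.mul_assoc]
  rw [Matrix.sub_mul, h1, Matrix.mul_add, Matrix.mul_one, h2, h3, e1, e2, neg_smul]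
  abel

/-- Ties the diagonal of `H_x` to products of off-diagonal entries of `H`: the commutator of the
second moment with a diagonal `s` has zero diagonal. -/
theorem commutator_mul_moment (hTS : T * S = 1) (hST : S * T = 1)
    (hD : T * A - A * T = A * V * K) (hK : K * sg = -(s * K)) (hV : sg * V = V * s)
    (hsgA : sg * A = A * sg) (hsg : T * sg + sg * T = sg + sg) :
    (s * (K * S * A * V) - (K * S * A * V) * s) * (K * S * A * V) =
      (K * S * A * A * V) * s - s * (K * S * A * A * V)
        + (-2 : ℂ) • (K * S * sg * A * S * A * V) := by
  have h1 : s * (K * S * A * V) * (K * S * A * V) =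
      -(K * sg * A * S * A * V) - s * (K * S * A * A * V) := by
    have h := inverse_displacement hTS hST hD
    calc s * (K * S * A * V) * (K * S * A * V) = s * K * (S * A * V * K * S) * A * V := by
          simp only [Matrix.mul_assoc]
      _ = _ := by
          rw [h, hK]
          simp only [Matrix.mul_sub, Matrix.sub_mul, Matrix.neg_mul, Matrix.mul_assoc, neg_neg]
  have h2 := moment_sign_mul hTS hST hD hK hsg (A * V)
  have h3 : (K * S * A * A * V) * s = K * S * A * sg * A * V := by
    rw [Matrix.mul_assoc _ V, ← hV, ← Matrix.mul_assoc, Matrix.mul_assoc _ A sg, ← hsgA,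
      ← Matrix.mul_assoc]
  have e1 : K * A * sg * S * A * V = K * sg * A * S * A * V := by
    rw [Matrix.mul_assoc K A, ← hsgA]; simp only [Matrix.mul_assoc]
  have e2 : K * S * A * sg * S * A * V = K * S * sg * A * S * A * V := by
    rw [Matrix.mul_assoc (K * S) A, ← hsgA]; simp only [Matrix.mul_assoc]
  simp only [← Matrix.mul_assoc] at h1 h2 h3 e1 e2 ⊢
  rw [e1, e2] at h2
  simp only [Matrix.sub_mul]
  rw [h1, h2, h3, neg_smul]
  abel

/-- Sylvester's identity replaces the determinant by that of `(T + V K) S`, and `T + V K = A⁻¹ T A`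
has the determinant of `T`. -/
theorem det_dressing [DecidableEq κ] (hTS : T * S = 1) (hA : IsUnit A)
    (hD : T * A - A * T = A * V * K) : (1 + K * S * V).det = 1 := by
  obtain ⟨B, hBA⟩ := hA.exists_left_inv
  have hTVK : T + V * K = B * T * A := by
    have : B * (T * A - A * T) = B * (A * V * K) := by rw [hD]
    simp only [Matrix.mul_sub, ← Matrix.mul_assoc, hBA, Matrix.one_mul] at this
    rw [← this]; abel
  have hdT : T.det * S.det = 1 := by rw [← det_mul, hTS, det_one]
  have hdA : B.det * A.det = 1 := by rw [← det_mul, hBA, det_one]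
  have h1 : (1 + K * S * V).det = (1 + V * K * S).det := by
    rw [det_one_add_mul_comm, Matrix.mul_assoc]
  have h2 : 1 + V * K * S = B * T * A * S := by
    rw [← hTVK, Matrix.add_mul, hTS]
  rw [h1, h2, det_mul, det_mul, det_mul]
  linear_combination (B.det * A.det) * hdT + hdA

end Dressing

/-! ### Entrywise calculus of matrix functions. -/

section Calculus

variable {l m n : Type*}

/-- Entrywise derivative of a matrix-valued function of a real variable. -/
def HasMatDerivAt (F : ℝ → Matrix l m ℂ) (F' : Matrix l m ℂ) (x : ℝ) : Prop :=
  ∀ i j, HasDerivAt (fun y => F y i j) (F' i j) x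

theorem HasMatDerivAt.mul [Fintype m] {F : ℝ → Matrix l m ℂ} {F' : Matrix l m ℂ} {G : ℝ → Matrix m n ℂ}
    {G' : Matrix m n ℂ} {x : ℝ} (hF : HasMatDerivAt F F' x) (hG : HasMatDerivAt G G' x) :
    HasMatDerivAt (fun y => F y * G y) (F' * G x + F x * G') x := by
  intro i j
  simp only [Matrix.mul_apply, Matrix.add_apply, ← Finset.sum_add_distrib]
  exact HasDerivAt.fun_sum fun k _ => (hF i k).mul (hG k j)

theorem HasMatDerivAt.mul_const [Fintype m] {F : ℝ → Matrix l m ℂ} {F' : Matrix l m ℂ}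
    {x : ℝ} (hF : HasMatDerivAt F F' x) (B : Matrix m n ℂ) :
    HasMatDerivAt (fun y => F y * B) (F' * B) x := by
  have h : HasMatDerivAt (fun _ => B) (0 : Matrix m n ℂ) x := fun i j => hasDerivAt_const x _
  simpa using hF.mul h

theorem HasMatDerivAt.unique {F : ℝ → Matrix l m ℂ} {F' F'' : Matrix l m ℂ} {x : ℝ}
    (h : HasMatDerivAt F F' x) (h' : HasMatDerivAt F F'' x) : F' = F'' := by
  ext i j; exact (h i j).unique (h' i j)

variable [Fintype n] [DecidableEq n] {E : Type*} [NormedAddCommGroup E] [NormedSpace ℝ E]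

theorem contDiff_matrix_det {k : WithTop ℕ∞} {F : E → Matrix n n ℂ}
    (hF : ∀ i j, ContDiff ℝ k fun p => F p i j) : ContDiff ℝ k fun p => (F p).det := by
  simp only [det_apply, Units.smul_def, zsmul_eq_mul]
  exact ContDiff.sum fun g _ => contDiff_const.mul (contDiff_prod fun i _ => hF _ _)

theorem contDiff_matrix_mul [Fintype m] {o : Type*} {k : WithTop ℕ∞} {F : E → Matrix l m ℂ}
    {G : E → Matrix m o ℂ}
    (hF : ∀ i j, ContDiff ℝ k fun p => F p i j) (hG : ∀ i j, ContDiff ℝ k fun p => G p i j)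
    (i : l) (j : o) : ContDiff ℝ k fun p => (F p * G p) i j := by
  simp only [Matrix.mul_apply]
  exact ContDiff.sum fun a _ => (hF i a).mul (hG a j)

theorem contDiff_matrix_inv {k : WithTop ℕ∞} {F : E → Matrix n n ℂ}
    (hF : ∀ i j, ContDiff ℝ k fun p => F p i j) (hu : ∀ p, IsUnit (F p)) (i j : n) :
    ContDiff ℝ k fun p => (F p)⁻¹ i j := by
  have h0 : ∀ p, (F p).det ≠ 0 := fun p => ((isUnit_iff_isUnit_det _).1 (hu p)).ne_zero
  simp only [inv_def, Ring.inverse_eq_inv', Matrix.smul_apply, smul_eq_mul, adjugate_apply]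
  refine ((contDiff_matrix_det hF).inv h0).mul (contDiff_matrix_det fun a b => ?_)
  by_cases h : a = j
  · subst h; simp only [updateRow_self]; exact contDiff_const
  · simp only [updateRow_ne h]; exact hF a b

theorem HasMatDerivAt.inv {F : ℝ → Matrix n n ℂ} {F' : Matrix n n ℂ} {x : ℝ}
    (hF : HasMatDerivAt F F' x) (hsm : ∀ i j, ContDiff ℝ 1 fun p => F p i j)
    (hu : ∀ p, IsUnit (F p)) :
    HasMatDerivAt (fun y => (F y)⁻¹) (-((F x)⁻¹ * F' * (F x)⁻¹)) x := by
  -- Cramer's formula provides differentiability; the value then comes from differentiating `F F⁻¹ =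
  -- 1`.
  have hex : HasMatDerivAt (fun y => (F y)⁻¹)
      (Matrix.of fun i j => deriv (fun y => (F y)⁻¹ i j) x) x := fun i j =>
    ((contDiff_matrix_inv hsm hu i j).differentiable one_ne_zero x).hasDerivAt
  set G := Matrix.of fun i j => deriv (fun y => (F y)⁻¹ i j) x
  have hd : ∀ y, IsUnit (F y).det := fun y => (isUnit_iff_isUnit_det _).1 (hu y)
  have h1 := hF.mul hex
  have h2 : HasMatDerivAt (fun y => F y * (F y)⁻¹) 0 x := by
    simp only [fun y => mul_nonsing_inv (F y) (hd y)]
    exact fun i j => hasDerivAt_const x _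
  have h3 := h1.unique h2
  have h4 : G = -((F x)⁻¹ * F' * (F x)⁻¹) := by
    have : (F x)⁻¹ * (F' * (F x)⁻¹ + F x * G) = 0 := by rw [h3, Matrix.mul_zero]
    rw [Matrix.mul_add, ← Matrix.mul_assoc, ← Matrix.mul_assoc, nonsing_inv_mul _ (hd x),
      Matrix.one_mul] at this
    exact eq_neg_of_add_eq_zero_right this
  rwa [← h4]

/-- In `K P S - K S (T - 1) P S` the factor `S T = 1` cancels the first term. -/
theorem hasMatDerivAt_moment {κ : Type*} {T : ℝ → Matrix n n ℂ}
    {K : ℝ → Matrix κ n ℂ} {P : Matrix n n ℂ} {x : ℝ}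
    (hT : HasMatDerivAt T ((T x - 1) * P) x) (hK : HasMatDerivAt K (K x * P) x)
    (hsm : ∀ i j, ContDiff ℝ 1 fun p => T p i j) (hu : ∀ p, IsUnit (T p)) (B : Matrix n m ℂ) :
    HasMatDerivAt (fun y => K y * (T y)⁻¹ * B) (K x * (T x)⁻¹ * P * (T x)⁻¹ * B) x := by
  have h := (hK.mul (hT.inv hsm hu)).mul_const B
  have hd : (T x)⁻¹ * T x = 1 := nonsing_inv_mul _ ((isUnit_iff_isUnit_det _).1 (hu x))
  have e : K x * P * (T x)⁻¹ + K x * -((T x)⁻¹ * ((T x - 1) * P) * (T x)⁻¹) =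
      K x * (T x)⁻¹ * P * (T x)⁻¹ := by
    simp only [Matrix.sub_mul, Matrix.mul_sub, Matrix.one_mul, ← Matrix.mul_assoc, hd,
      Matrix.mul_neg]
    abel
  rwa [e] at h

end Calculus

/-! ### From the linear system to the two nonlinear equations. -/

section Zakharov

/-- A pair of vector functions driven by the zero-spectral-parameter limit of the AKNS pair with
potential `h` solves both systems, as `|ψ_x|² = |h|²`. -/
theorem solves_of_akns {ψ φ : ℝ → ℝ → Fin 2 → ℂ} {h h' : ℝ → ℝ → ℂ}
    (hψψ : ∀ t x, star (ψ t x) ⬝ᵥ ψ t x = 1) (hφφ : ∀ t x, star (φ t x) ⬝ᵥ φ t x = 1)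
    (hψφ : ∀ t x, star (ψ t x) ⬝ᵥ φ t x = 0)
    (hψx : ∀ t x, HasDerivAt (fun y => ψ t y) ((-Complex.I * h t x) • φ t x) x)
    (hφx : ∀ t x, HasDerivAt (fun y => φ t y) ((-Complex.I * star (h t x)) • ψ t x) x)
    (hψt : ∀ t x, HasDerivAt (fun s => ψ s x)
      (h' t x • φ t x + (Complex.I * (h t x * star (h t x))) • ψ t x) t)
    (hhx : ∀ t x, HasDerivAt (fun y => h t y) (h' t x) x) :
    SolvesConstrained ψ ∧ SolvesGradientNLSE ψ := by
  have hdx : ∀ t x, dx ψ t x = (-Complex.I * h t x) • φ t x := fun t x => (hψx t x).deriv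
  have hdt : ∀ t x, dt ψ t x =
      h' t x • φ t x + (Complex.I * (h t x * star (h t x))) • ψ t x := fun t x => (hψt t x).deriv
  have hdxx : ∀ t x, dx (dx ψ) t x =
      (-Complex.I * h' t x) • φ t x - (h t x * star (h t x)) • ψ t x := by
    intro t x
    have e : (fun y => dx ψ t y) = fun y => (-Complex.I * h t y) • φ t y := funext fun y => hdx t y
    rw [dx, e]
    refine (((hhx t x).const_mul (-Complex.I)).smul (hφx t x)).deriv.trans ?_
    rw [smul_smul, add_comm, sub_eq_add_neg, ← neg_smul]
    congr 2
    linear_combination (h t x * star (h t x)) * Complex.I_mul_I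
  have hgrad : ∀ t x, star (dx ψ t x) ⬝ᵥ dx ψ t x = h t x * star (h t x) := by
    intro t x
    have hI : star Complex.I = -Complex.I := Complex.conj_I
    rw [hdx, star_smul, smul_dotProduct, dotProduct_smul, hφφ, star_mul', star_neg, hI]
    simp only [smul_eq_mul]
    linear_combination (-(h t x * star (h t x))) * Complex.I_mul_I
  have hreal : ∀ t x, h t x * star (h t x) = ((Complex.normSq (h t x) : ℝ) : ℂ) :=
    fun t x => Complex.mul_conj _
  -- Orthonormality gives `ψ†ψ_t = i |h|²`, so both summands of the multiplier equal `|h|²`.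
  have hmult : ∀ t x, (multiplier ψ t x : ℂ) = 2 * (h t x * star (h t x)) := by
    intro t x
    rw [multiplier, hgrad, hdt, dotProduct_add, dotProduct_smul, dotProduct_smul, hψψ, hψφ, hreal]
    rw [smul_zero, zero_add, smul_eq_mul, mul_one, Complex.ofReal_re, Complex.I_mul_im,
      Complex.ofReal_re]
    push_cast; ring
  have hsol : SolvesGradientNLSE ψ := by
    intro t x
    rw [hdt, hdxx, hgrad]
    funext i
    simp only [Pi.add_apply, Pi.sub_apply, Pi.smul_apply, smul_eq_mul, Pi.zero_apply]
    linear_combination (h t x * star (h t x) * ψ t x i) * Complex.I_mul_I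
  refine ⟨fun t x => ⟨hψψ t x, ?_⟩, hsol⟩
  rw [hmult, ← hgrad]
  exact hsol t x

theorem hasDerivAt_mulVec (U : Matrix (Fin 2) (Fin 2) ℂ) {v : ℝ → Fin 2 → ℂ} {v' : Fin 2 → ℂ}
    {x : ℝ} (hv : HasDerivAt v v' x) : HasDerivAt (fun y => U *ᵥ v y) (U *ᵥ v') x := by
  rw [hasDerivAt_pi] at hv ⊢
  intro i
  simp only [mulVec, dotProduct]
  exact HasDerivAt.fun_sum fun k _ => (hv k).const_mul _

theorem star_mulVec_dotProduct {U : Matrix (Fin 2) (Fin 2) ℂ}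
    (hU : U ∈ Matrix.unitaryGroup (Fin 2) ℂ) (v w : Fin 2 → ℂ) :
    star (U *ᵥ v) ⬝ᵥ (U *ᵥ w) = star v ⬝ᵥ w := by
  rw [star_mulVec, ← dotProduct_mulVec, mulVec_mulVec, ← star_eq_conjTranspose,
    Unitary.star_mul_self_of_mem hU, one_mulVec]

end Zakharov

/-! ### The concrete block matrices and their symmetries. -/

section Blocks

variable {N : ℕ}

/-- The block matrix whose inverse defines the dressing matrix. -/
def blockT (Y : Matrix (Fin N) (Fin N) ℂ) : Matrix (Fin N ⊕ Fin N) (Fin N ⊕ Fin N) ℂ :=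
  fromBlocks 1 (-conjM Y) Y 1

def blockK (q : Fin N → ℂ) : Matrix (Unit ⊕ Unit) (Fin N ⊕ Fin N) ℂ :=
  fromBlocks 0 (-replicateRow Unit (star q)) (replicateRow Unit q) 0

def blockV (N : ℕ) : Matrix (Fin N ⊕ Fin N) (Unit ⊕ Unit) ℂ :=
  fromBlocks (replicateCol Unit 1) 0 0 (replicateCol Unit 1)

/-- The diagonal matrix with blocks `diag c` and its conjugate. -/
def blockDiag (c : Fin N → ℂ) : Matrix (Fin N ⊕ Fin N) (Fin N ⊕ Fin N) ℂ :=
  fromBlocks (diagonal c) 0 0 (diagonal (star c))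

def signs (n : Type*) [DecidableEq n] : Matrix (n ⊕ n) (n ⊕ n) ℂ := fromBlocks 1 0 0 (-1)

/-- The symplectic unit. -/
def symp (n : Type*) [DecidableEq n] : Matrix (n ⊕ n) (n ⊕ n) ℂ := fromBlocks 0 1 (-1) 0

theorem conjM_mul {l m n : Type*} [Fintype m] (A : Matrix l m ℂ) (B : Matrix m n ℂ) :
    conjM (A * B) = conjM A * conjM B := Matrix.map_mul

theorem blockT_anticomm (Y : Matrix (Fin N) (Fin N) ℂ) :
    blockT Y * signs (Fin N) + signs (Fin N) * blockT Y = signs (Fin N) + signs (Fin N) := by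
  simp [blockT, signs, fromBlocks_multiply, fromBlocks_add]

theorem blockK_signs (q : Fin N → ℂ) :
    blockK q * signs (Fin N) = -(signs Unit * blockK q) := by
  simp [blockK, signs, fromBlocks_multiply, fromBlocks_neg]

theorem signs_blockV : signs (Fin N) * blockV N = blockV N * signs Unit := by
  simp [blockV, signs, fromBlocks_multiply]

theorem signs_blockDiag (c : Fin N → ℂ) :
    signs (Fin N) * blockDiag c = blockDiag c * signs (Fin N) := by
  simp [-fromBlocks_diagonal, blockDiag, signs, fromBlocks_multiply]

theorem blockDiag_mul (c d : Fin N → ℂ) : blockDiag c * blockDiag d = blockDiag (c * d) := by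
  simp only [blockDiag, fromBlocks_multiply, diagonal_mul_diagonal, Matrix.mul_zero,
    Matrix.zero_mul, add_zero, zero_add, star_mul']
  rfl

/-- Conjugation in the second block flips the sign of `-i`; this is how the sign matrix enters the
flows. -/
theorem blockDiag_eq_smul_signs (c : Fin N → ℂ) :
    blockDiag (fun k => -Complex.I * c k) = -Complex.I • (signs (Fin N) * blockDiag c) := by
  have h1 : (diagonal fun k => -Complex.I * c k) = -Complex.I • diagonal c := by
    rw [← diagonal_smul]; rfl
  have h2 : (diagonal (star fun k => -Complex.I * c k)) = Complex.I • diagonal (star c) := by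
    rw [← diagonal_smul]
    congr 1
    funext k
    simp
  rw [blockDiag, h1, h2]
  simp only [blockDiag, signs, fromBlocks_multiply, fromBlocks_smul, Matrix.one_mul,
    Matrix.zero_mul, Matrix.mul_zero, Matrix.neg_mul, add_zero, zero_add, smul_zero, smul_neg,
    neg_smul, fromBlocks_neg, neg_neg, neg_zero]

/-- The quaternionic reality condition. It passes to products and inverses, hence from the blocks to
the `2 × 2` moments. -/
theorem blockT_symp (Y : Matrix (Fin N) (Fin N) ℂ) :
    blockT Y * symp (Fin N) = symp (Fin N) * conjM (blockT Y) := by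
  have : conjM (blockT Y) = fromBlocks 1 (-Y) (conjM Y) 1 := by
    ext (i | i) (j | j) <;> simp [conjM, blockT, one_apply, apply_ite]
  rw [this]
  simp [blockT, symp, fromBlocks_multiply]

theorem blockK_symp (q : Fin N → ℂ) :
    blockK q * symp (Fin N) = symp Unit * conjM (blockK q) := by
  have : conjM (blockK q) = fromBlocks 0 (-replicateRow Unit q) (replicateRow Unit (star q)) 0 := by
    ext (i | i) (j | j) <;> simp [conjM, blockK]
  rw [this]
  simp [blockK, symp, fromBlocks_multiply]

theorem blockV_symp : blockV N * symp Unit = symp (Fin N) * conjM (blockV N) := by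
  have : conjM (blockV N) = blockV N := by
    ext (i | i) (j | j) <;> simp [conjM, blockV]
  rw [this]
  simp [blockV, symp, fromBlocks_multiply]

theorem blockDiag_symp (c : Fin N → ℂ) :
    blockDiag c * symp (Fin N) = symp (Fin N) * conjM (blockDiag c) := by
  have : conjM (blockDiag c) = fromBlocks (diagonal (star c)) 0 0 (diagonal c) := by
    have hc : ∀ d : Fin N → ℂ, conjM (diagonal d) = diagonal (star d) := fun d =>
      diagonal_map (map_zero _)
    have h0 : conjM (0 : Matrix (Fin N) (Fin N) ℂ) = 0 := by ext; simp [conjM]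
    rw [blockDiag, conjM, fromBlocks_map]
    change fromBlocks (conjM _) (conjM _) (conjM _) (conjM _) = _
    rw [hc, hc, h0, star_star]
  rw [this]
  simp [-fromBlocks_diagonal, blockDiag, symp, fromBlocks_multiply]

theorem inv_symp {T : Matrix (Fin N ⊕ Fin N) (Fin N ⊕ Fin N) ℂ} (hT : IsUnit T)
    (h : T * symp (Fin N) = symp (Fin N) * conjM T) :
    T⁻¹ * symp (Fin N) = symp (Fin N) * conjM T⁻¹ := by
  have hd := (isUnit_iff_isUnit_det _).1 hT
  have h1 : conjM T * conjM T⁻¹ = 1 := by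
    rw [← conjM_mul, mul_nonsing_inv _ hd]
    ext i j; simp [conjM, one_apply, apply_ite]
  calc T⁻¹ * symp (Fin N) = T⁻¹ * (symp (Fin N) * conjM T) * conjM T⁻¹ := by
        rw [Matrix.mul_assoc, Matrix.mul_assoc, h1, Matrix.mul_one]
    _ = _ := by rw [← h, ← Matrix.mul_assoc, nonsing_inv_mul _ hd, Matrix.one_mul]

theorem moment_symp {S : Matrix (Fin N ⊕ Fin N) (Fin N ⊕ Fin N) ℂ} (q : Fin N → ℂ)
    {B : Matrix (Fin N ⊕ Fin N) (Unit ⊕ Unit) ℂ}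
    (hS : S * symp (Fin N) = symp (Fin N) * conjM S)
    (hB : B * symp Unit = symp (Fin N) * conjM B) :
    (blockK q * S * B) * symp Unit = symp Unit * conjM (blockK q * S * B) := by
  rw [Matrix.mul_assoc _ B, hB, ← Matrix.mul_assoc, Matrix.mul_assoc _ S, hS, ← Matrix.mul_assoc,
    blockK_symp, conjM_mul, conjM_mul]
  simp only [Matrix.mul_assoc]

theorem entries_of_symp {X : Matrix (Unit ⊕ Unit) (Unit ⊕ Unit) ℂ}
    (h : X * symp Unit = symp Unit * conjM X) :
    X (.inl ()) (.inl ()) = star (X (.inr ()) (.inr ())) ∧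
      X (.inl ()) (.inr ()) = -star (X (.inr ()) (.inl ())) := by
  have h1 := congrFun (congrFun h (.inl ())) (.inr ())
  have h2 := congrFun (congrFun h (.inl ())) (.inl ())
  simp [mul_apply, symp, conjM] at h1 h2
  exact ⟨h1, by rw [← neg_eq_iff_eq_neg]; exact h2⟩

theorem isUnit_blockT {Y : Matrix (Fin N) (Fin N) ℂ} (h : IsUnit (1 + conjM Y * Y)) :
    IsUnit (blockT Y) := by
  rw [isUnit_iff_isUnit_det] at h ⊢
  rwa [blockT, det_fromBlocks_one₂₂, Matrix.neg_mul, sub_neg_eq_add]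

theorem isUnit_blockDiag {c : Fin N → ℂ} (hc : ∀ k, c k ≠ 0) : IsUnit (blockDiag c) := by
  rw [isUnit_iff_isUnit_det, blockDiag, det_fromBlocks_zero₂₁, det_diagonal, det_diagonal,
    isUnit_iff_ne_zero]
  exact mul_ne_zero (Finset.prod_ne_zero_iff.2 fun k _ => hc k)
    (Finset.prod_ne_zero_iff.2 fun k _ => star_ne_zero.2 (hc k))

variable {L : Fin N → ℂ}

/-- The diagonal entries `1 / L_k^* = L_k / |L_k|²`. -/
def invConj (L : Fin N → ℂ) (k : Fin N) : ℂ := (starRingEnd ℂ (L k))⁻¹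

theorem invConj_ne_zero (hLc : ∀ j k, L j ≠ starRingEnd ℂ (L k)) (k : Fin N) :
    invConj L k ≠ 0 := by
  simpa [invConj] using ne_zero_of_ne_conj hLc k

/-- The lower left block is `matC_displacement` divided by `L_j L_k^*`, the upper right one its
conjugate; the diagonal blocks vanish on both sides. -/
theorem block_displacement (hLc : ∀ j k, L j ≠ starRingEnd ℂ (L k)) (e : Fin N → ℂ) :
    blockT (matC L * diagonal e) * blockDiag (invConj L) -
      blockDiag (invConj L) * blockT (matC L * diagonal e) =
      blockDiag (invConj L) * blockV N * blockK (fun k => e k * invConj L k) := by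
  have key : ∀ j k, matC L j k * e k * invConj L k =
      star (invConj L j) * (matC L j k * e k) + star (invConj L j) * (e k * invConj L k) := by
    intro j k
    have h := matC_displacement hLc j k
    have hj := ne_zero_of_ne_conj hLc j
    have hk : starRingEnd ℂ (L k) ≠ 0 := by simpa using ne_zero_of_ne_conj hLc k
    have hs : star (invConj L j) = (L j)⁻¹ := by simp [invConj]
    rw [hs, invConj]
    field_simp
    linear_combination (-e k) * h
  ext (i | i) (j | j)
  · simp [-fromBlocks_diagonal, blockT, blockDiag, blockV, blockK, fromBlocks_multiply]
  · have := congrArg (starRingEnd ℂ) (key i j)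
    simp only [map_add, map_mul] at this
    simp [-fromBlocks_diagonal, blockT, blockDiag, blockV, blockK, fromBlocks_multiply, conjM, mul_apply,
      diagonal_apply] at this ⊢
    linear_combination -this
  · have := key i j
    simp [-fromBlocks_diagonal, blockT, blockDiag, blockV, blockK, fromBlocks_multiply, mul_apply,
      diagonal_apply] at this ⊢
    linear_combination this
  · simp [-fromBlocks_diagonal, blockT, blockDiag, blockV, blockK, fromBlocks_multiply]

end Blocks

/-! ### Exponential phases and the flows of the blocks. -/

section Soliton

variable {N : ℕ}

/-- The entries of `E(t,x)`. -/
def expE (L : Fin N → ℂ) (f₀ φ₀ : Fin N → ℝ) (t x : ℝ) (k : Fin N) : ℂ :=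
  Complex.exp ((phaseF (L k) (f₀ k) t x : ℂ) + Complex.I * (phasePhi (L k) (φ₀ k) t x : ℂ))

theorem expE_ne_zero (L : Fin N → ℂ) (f₀ φ₀ : Fin N → ℝ) (t x : ℝ) (k : Fin N) :
    expE L f₀ φ₀ t x k ≠ 0 := Complex.exp_ne_zero _

theorem matY_eq (L : Fin N → ℂ) (f₀ φ₀ : Fin N → ℝ) (t x : ℝ) :
    matY L f₀ φ₀ t x = matC L * diagonal (expE L f₀ φ₀ t x) := rfl

theorem invConj_eq (L : Fin N → ℂ) (k : Fin N) :
    invConj L k = (mu (L k) : ℂ) + (nu (L k) : ℂ) * Complex.I := by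
  rw [mu, nu, Complex.re_add_im, invConj]
  by_cases h : L k = 0
  · simp [h]
  · have h2 : starRingEnd ℂ (L k) ≠ 0 := by simpa using h
    rw [← Complex.normSq_eq_norm_sq, ← Complex.mul_conj]
    field_simp

theorem expE_eq (L : Fin N → ℂ) (f₀ φ₀ : Fin N → ℝ) (t x : ℝ) (k : Fin N) :
    expE L f₀ φ₀ t x k = Complex.exp (-Complex.I * invConj L k * (x : ℂ) +
      -Complex.I * (invConj L k * invConj L k) * (t : ℂ) +
      ((f₀ k : ℂ) + Complex.I * (φ₀ k : ℂ))) := by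
  rw [expE, invConj_eq, phaseF, phasePhi]
  congr 1
  push_cast
  linear_combination ((nu (L k) : ℂ) * x + 2 * (mu (L k) : ℂ) * (nu (L k) : ℂ) * t +
    Complex.I * (nu (L k) : ℂ) ^ 2 * t) * Complex.I_mul_I

theorem hasDerivAt_expE_x (L : Fin N → ℂ) (f₀ φ₀ : Fin N → ℝ) (t x : ℝ) (k : Fin N) :
    HasDerivAt (fun y => expE L f₀ φ₀ t y k) (-Complex.I * invConj L k * expE L f₀ φ₀ t x k) x := by
  simp only [expE_eq]
  have h := (((Complex.ofRealCLM.hasDerivAt (x := x)).const_mul (-Complex.I * invConj L k)).add_const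
    (-Complex.I * (invConj L k * invConj L k) * (t : ℂ))).add_const
      ((f₀ k : ℂ) + Complex.I * (φ₀ k : ℂ))
  refine h.cexp.congr_deriv ?_
  rw [show Complex.ofRealCLM 1 = 1 from Complex.ofReal_one, mul_one, mul_comm]
  rfl

theorem hasDerivAt_expE_t (L : Fin N → ℂ) (f₀ φ₀ : Fin N → ℝ) (t x : ℝ) (k : Fin N) :
    HasDerivAt (fun s => expE L f₀ φ₀ s x k)
      (-Complex.I * (invConj L k * invConj L k) * expE L f₀ φ₀ t x k) t := by
  simp only [expE_eq]
  have h := (((Complex.ofRealCLM.hasDerivAt (x := t)).const_mul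
    (-Complex.I * (invConj L k * invConj L k))).const_add
    (-Complex.I * invConj L k * (x : ℂ))).add_const ((f₀ k : ℂ) + Complex.I * (φ₀ k : ℂ))
  refine h.cexp.congr_deriv ?_
  rw [show Complex.ofRealCLM 1 = 1 from Complex.ofReal_one, mul_one, mul_comm]
  rfl

theorem contDiff_expE (L : Fin N → ℂ) (f₀ φ₀ : Fin N → ℝ) (k : Fin N) :
    ContDiff ℝ ∞ fun p : ℝ × ℝ => expE L f₀ φ₀ p.1 p.2 k := by
  simp only [expE_eq]
  have h1 : ContDiff ℝ ∞ fun p : ℝ × ℝ => (p.1 : ℂ) := Complex.ofRealCLM.contDiff.comp contDiff_fst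
  have h2 : ContDiff ℝ ∞ fun p : ℝ × ℝ => (p.2 : ℂ) := Complex.ofRealCLM.contDiff.comp contDiff_snd
  exact (((contDiff_const.mul h2).add (contDiff_const.mul h1)).add contDiff_const).cexp

/-! ### Derivatives and smoothness of the blocks, as functions of the entries of `E` -/

theorem _root_.HasDerivAt.complex_conj {f : ℝ → ℂ} {f' : ℂ} {x : ℝ} (h : HasDerivAt f f' x) :
    HasDerivAt (fun y => starRingEnd ℂ (f y)) (starRingEnd ℂ f') x :=
  Complex.conjCLE.toContinuousLinearMap.hasFDerivAt.comp_hasDerivAt x h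

theorem hasMatDerivAt_blockT (L : Fin N → ℂ) {e : ℝ → Fin N → ℂ} {c : Fin N → ℂ} {x : ℝ}
    (he : ∀ k, HasDerivAt (fun y => e y k) (c k * e x k) x) :
    HasMatDerivAt (fun y => blockT (matC L * diagonal (e y)))
      ((blockT (matC L * diagonal (e x)) - 1) * blockDiag c) x := by
  have hP : (blockT (matC L * diagonal (e x)) - 1) * blockDiag c =
      fromBlocks 0 (-(conjM (matC L * diagonal (e x)) * diagonal (star c)))
        (matC L * diagonal (e x) * diagonal c) 0 := by
    rw [blockT, ← fromBlocks_one, sub_eq_add_neg, fromBlocks_neg, fromBlocks_add, blockDiag,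
      fromBlocks_multiply]
    simp only [add_neg_cancel, neg_zero, add_zero, Matrix.zero_mul, Matrix.mul_zero, zero_add,
      Matrix.neg_mul]
  rw [hP]
  rintro (i | i) (j | j)
  · simpa [blockT] using hasDerivAt_const x _
  · have h := (((he j).complex_conj).const_mul (starRingEnd ℂ (matC L i j))).neg
    simp only [blockT, fromBlocks_apply₁₂, Matrix.neg_apply, mul_diagonal, conjM, map_apply,
      map_mul, Pi.star_apply] at h ⊢
    refine h.congr_deriv ?_
    simp only [Complex.star_def]
    ring
  · have h := (he j).const_mul (matC L i j)
    simp only [blockT, fromBlocks_apply₂₁, mul_diagonal] at h ⊢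
    exact h.congr_deriv (by ring)
  · simpa [blockT] using hasDerivAt_const x _

theorem hasMatDerivAt_blockK {q : ℝ → Fin N → ℂ} {c : Fin N → ℂ} {x : ℝ}
    (hq : ∀ k, HasDerivAt (fun y => q y k) (c k * q x k) x) :
    HasMatDerivAt (fun y => blockK (q y)) (blockK (q x) * blockDiag c) x := by
  rw [blockDiag, blockK, fromBlocks_multiply]
  simp only [Matrix.zero_mul, Matrix.mul_zero, add_zero, zero_add]
  rintro (i | i) (j | j)
  · simpa [blockK] using hasDerivAt_const x _
  · have h := ((hq j).complex_conj).neg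
    simp only [blockK, fromBlocks_apply₁₂, Matrix.neg_apply, mul_diagonal, replicateRow_apply,
      map_mul, Pi.star_apply] at h ⊢
    refine h.congr_deriv ?_
    simp only [Complex.star_def]
    ring
  · simp only [blockK, fromBlocks_apply₂₁, mul_diagonal, replicateRow_apply]
    exact (hq j).congr_deriv (mul_comm _ _)
  · simpa [blockK] using hasDerivAt_const x _

variable {E : Type*} [NormedAddCommGroup E] [NormedSpace ℝ E] {n : WithTop ℕ∞}

theorem _root_.ContDiff.complex_conj {f : E → ℂ} (h : ContDiff ℝ n f) :
    ContDiff ℝ n fun p => starRingEnd ℂ (f p) :=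
  Complex.conjCLE.contDiff.comp h

theorem contDiff_blockT (L : Fin N → ℂ) {e : E → Fin N → ℂ}
    (he : ∀ k, ContDiff ℝ n fun p => e p k) (i j : Fin N ⊕ Fin N) :
    ContDiff ℝ n fun p => blockT (matC L * diagonal (e p)) i j := by
  rcases i with i | i <;> rcases j with j | j
  · exact contDiff_const
  · simp only [blockT, fromBlocks_apply₁₂, Matrix.neg_apply, mul_diagonal, conjM, map_apply]
    exact (contDiff_const.mul (he j)).complex_conj.neg
  · simp only [blockT, fromBlocks_apply₂₁, mul_diagonal]
    exact contDiff_const.mul (he j)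
  · exact contDiff_const

theorem contDiff_blockK {q : E → Fin N → ℂ} (hq : ∀ k, ContDiff ℝ n fun p => q p k)
    (i : Unit ⊕ Unit) (j : Fin N ⊕ Fin N) : ContDiff ℝ n fun p => blockK (q p) i j := by
  rcases i with i | i <;> rcases j with j | j
  · exact contDiff_const
  · exact (hq j).complex_conj.neg
  · exact hq j
  · exact contDiff_const

end Soliton

/-! ### The dressing matrix and the soliton as its second row. -/

section Dressed

theorem hasDerivAt_row {F : ℝ → Matrix (Unit ⊕ Unit) (Unit ⊕ Unit) ℂ}
    {F' : Matrix (Unit ⊕ Unit) (Unit ⊕ Unit) ℂ} {x : ℝ} (h : HasMatDerivAt F F' x)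
    (i : Unit ⊕ Unit) : HasDerivAt (fun y => ![F y i (.inl ()), F y i (.inr ())])
      ![F' i (.inl ()), F' i (.inr ())] x := by
  rw [hasDerivAt_pi]
  intro j
  fin_cases j
  · exact h i (.inl ())
  · exact h i (.inr ())

variable {N : ℕ} (L : Fin N → ℂ) (f₀ φ₀ : Fin N → ℝ)

def solT (t x : ℝ) : Matrix (Fin N ⊕ Fin N) (Fin N ⊕ Fin N) ℂ :=
  blockT (matC L * diagonal (expE L f₀ φ₀ t x))

def solK (t x : ℝ) : Matrix (Unit ⊕ Unit) (Fin N ⊕ Fin N) ℂ :=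
  blockK fun k => expE L f₀ φ₀ t x k * invConj L k

/-- The dressing matrix at zero spectral parameter. -/
def solW (t x : ℝ) : Matrix (Unit ⊕ Unit) (Unit ⊕ Unit) ℂ :=
  1 + solK L f₀ φ₀ t x * (solT L f₀ φ₀ t x)⁻¹ * blockV N

/-- The first moment of the dressing matrix, which carries the AKNS potential. -/
def solH (t x : ℝ) : Matrix (Unit ⊕ Unit) (Unit ⊕ Unit) ℂ :=
  solK L f₀ φ₀ t x * (solT L f₀ φ₀ t x)⁻¹ * blockDiag (invConj L) * blockV N

/-- The `x`-derivative of `solH`. -/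
def solHx (t x : ℝ) : Matrix (Unit ⊕ Unit) (Unit ⊕ Unit) ℂ :=
  -Complex.I • (solK L f₀ φ₀ t x * (solT L f₀ φ₀ t x)⁻¹ * signs (Fin N) * blockDiag (invConj L) *
    (solT L f₀ φ₀ t x)⁻¹ * blockDiag (invConj L) * blockV N)

variable {L} (hL : Function.Injective L) (hLc : ∀ j k, L j ≠ starRingEnd ℂ (L k))
include hL hLc

theorem isUnit_solT (t x : ℝ) : IsUnit (solT L f₀ φ₀ t x) :=
  isUnit_blockT (isUnit_one_add_conj_mul_self hL hLc (expE_ne_zero L f₀ φ₀ t x) rfl)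

theorem solT_mul_inv (t x : ℝ) : solT L f₀ φ₀ t x * (solT L f₀ φ₀ t x)⁻¹ = 1 :=
  mul_nonsing_inv _ ((isUnit_iff_isUnit_det _).1 (isUnit_solT f₀ φ₀ hL hLc t x))

theorem inv_mul_solT (t x : ℝ) : (solT L f₀ φ₀ t x)⁻¹ * solT L f₀ φ₀ t x = 1 :=
  nonsing_inv_mul _ ((isUnit_iff_isUnit_det _).1 (isUnit_solT f₀ φ₀ hL hLc t x))

theorem hasMatDerivAt_sol_x (B : Matrix (Fin N ⊕ Fin N) (Unit ⊕ Unit) ℂ) (t x : ℝ) :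
    HasMatDerivAt (fun y => solK L f₀ φ₀ t y * (solT L f₀ φ₀ t y)⁻¹ * B)
      (-Complex.I • (solK L f₀ φ₀ t x * (solT L f₀ φ₀ t x)⁻¹ * signs (Fin N) *
        blockDiag (invConj L) * (solT L f₀ φ₀ t x)⁻¹ * B)) x := by
  have hT := hasMatDerivAt_blockT L (hasDerivAt_expE_x L f₀ φ₀ t x)
  have hK := hasMatDerivAt_blockK (q := fun y k => expE L f₀ φ₀ t y k * invConj L k)
    (c := fun k => -Complex.I * invConj L k) (x := x)
    fun k => ((hasDerivAt_expE_x L f₀ φ₀ t x k).mul_const (invConj L k)).congr_deriv (by ring)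
  have h := hasMatDerivAt_moment hT hK
    (contDiff_blockT L fun k => ((contDiff_expE L f₀ φ₀ k).of_le (by simp)).comp
      (contDiff_prodMk_right t)) (isUnit_solT f₀ φ₀ hL hLc t) B
  rw [blockDiag_eq_smul_signs] at h
  simp only [Matrix.mul_smul, Matrix.smul_mul, ← Matrix.mul_assoc] at h
  exact h

theorem hasMatDerivAt_sol_t (B : Matrix (Fin N ⊕ Fin N) (Unit ⊕ Unit) ℂ) (t x : ℝ) :
    HasMatDerivAt (fun s => solK L f₀ φ₀ s x * (solT L f₀ φ₀ s x)⁻¹ * B)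
      (-Complex.I • (solK L f₀ φ₀ t x * (solT L f₀ φ₀ t x)⁻¹ * signs (Fin N) *
        blockDiag (invConj L) * blockDiag (invConj L) * (solT L f₀ φ₀ t x)⁻¹ * B)) t := by
  have hT := hasMatDerivAt_blockT L (hasDerivAt_expE_t L f₀ φ₀ t x)
  have hK := hasMatDerivAt_blockK (q := fun s k => expE L f₀ φ₀ s x k * invConj L k)
    (c := fun k => -Complex.I * (invConj L k * invConj L k)) (x := t)
    fun k => ((hasDerivAt_expE_t L f₀ φ₀ t x k).mul_const (invConj L k)).congr_deriv (by ring)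
  have h := hasMatDerivAt_moment hT hK
    (contDiff_blockT L fun k => ((contDiff_expE L f₀ φ₀ k).of_le (by simp)).comp
      (contDiff_prodMk_left x)) (fun s => isUnit_solT f₀ φ₀ hL hLc s x) B
  have e := blockDiag_eq_smul_signs (fun k => invConj L k * invConj L k)
  have e2 : blockDiag (fun k => invConj L k * invConj L k) =
      blockDiag (invConj L) * blockDiag (invConj L) := (blockDiag_mul _ _).symm
  rw [e, e2] at h
  simp only [Matrix.mul_smul, Matrix.smul_mul, ← Matrix.mul_assoc] at h
  exact h

theorem hasMatDerivAt_solW_x (t x : ℝ) : HasMatDerivAt (fun y => solW L f₀ φ₀ t y)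
    ((Complex.I / 2) • ((signs Unit * solH L f₀ φ₀ t x - solH L f₀ φ₀ t x * signs Unit) *
      solW L f₀ φ₀ t x)) x := by
  have h := hasMatDerivAt_sol_x f₀ φ₀ hL hLc (blockV N) t x
  have e := commutator_mul_dressing (solT_mul_inv f₀ φ₀ hL hLc t x) (inv_mul_solT f₀ φ₀ hL hLc t x)
    (block_displacement hLc _) (blockK_signs fun k => expE L f₀ φ₀ t x k * invConj L k)
    signs_blockV (signs_blockDiag _) (blockT_anticomm _)
  rw [solH, solW, solK, e, smul_smul, show Complex.I / 2 * (-2) = -Complex.I by ring]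
  exact fun i j => (h i j).const_add _

theorem hasMatDerivAt_solW_t (t x : ℝ) : HasMatDerivAt (fun s => solW L f₀ φ₀ s x)
    (solHx L f₀ φ₀ t x * solW L f₀ φ₀ t x) t := by
  have h := hasMatDerivAt_sol_t f₀ φ₀ hL hLc (blockV N) t x
  have e := dressing_time (solT_mul_inv f₀ φ₀ hL hLc t x) (inv_mul_solT f₀ φ₀ hL hLc t x)
    (block_displacement hLc _) (K := solK L f₀ φ₀ t x) (signs (Fin N) * blockDiag (invConj L))
  simp only [← Matrix.mul_assoc] at e
  rw [solHx, solW, Matrix.smul_mul, e]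
  exact fun i j => (h i j).const_add _

theorem hasMatDerivAt_solH_x (t x : ℝ) : HasMatDerivAt (fun y => solH L f₀ φ₀ t y)
    (solHx L f₀ φ₀ t x) x := by
  have h := hasMatDerivAt_sol_x f₀ φ₀ hL hLc (blockDiag (invConj L) * blockV N) t x
  simp only [← Matrix.mul_assoc] at h
  exact h

theorem solHx_inr_inr (t x : ℝ) : solHx L f₀ φ₀ t x (.inr ()) (.inr ()) =
    -Complex.I * (solH L f₀ φ₀ t x (.inr ()) (.inl ()) * solH L f₀ φ₀ t x (.inl ()) (.inr ())) := by
  have e := commutator_mul_moment (solT_mul_inv f₀ φ₀ hL hLc t x) (inv_mul_solT f₀ φ₀ hL hLc t x)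
    (block_displacement hLc _) (blockK_signs fun k => expE L f₀ φ₀ t x k * invConj L k)
    signs_blockV (signs_blockDiag _) (blockT_anticomm _)
  set X := blockK (fun k => expE L f₀ φ₀ t x k * invConj L k) * (solT L f₀ φ₀ t x)⁻¹ *
    signs (Fin N) * blockDiag (invConj L) * (solT L f₀ φ₀ t x)⁻¹ * blockDiag (invConj L) * blockV N
    with hX
  have hHx : solHx L f₀ φ₀ t x = -Complex.I • X := rfl
  have hH : blockK (fun k => expE L f₀ φ₀ t x k * invConj L k) * (solT L f₀ φ₀ t x)⁻¹ *
    blockDiag (invConj L) * blockV N = solH L f₀ φ₀ t x := rfl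
  rw [hH] at e
  have e1 := congrFun (congrFun e (.inr ())) (.inr ())
  -- On the diagonal the second-moment commutator drops out, leaving `H_21 H_12 = X_22`.
  simp [-neg_smul, Matrix.mul_apply, signs, Matrix.sub_apply, Matrix.add_apply] at e1
  rw [hHx, Matrix.smul_apply, smul_eq_mul]
  linear_combination (-Complex.I / 2) * e1

theorem det_solW (t x : ℝ) : (solW L f₀ φ₀ t x).det = 1 :=
  det_dressing (solT_mul_inv f₀ φ₀ hL hLc t x) (isUnit_blockDiag (invConj_ne_zero hLc))
    (block_displacement hLc _)

theorem solW_entries (t x : ℝ) :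
    solW L f₀ φ₀ t x (.inl ()) (.inl ()) = star (solW L f₀ φ₀ t x (.inr ()) (.inr ())) ∧
    solW L f₀ φ₀ t x (.inl ()) (.inr ()) = -star (solW L f₀ φ₀ t x (.inr ()) (.inl ())) := by
  refine entries_of_symp ?_
  have h := moment_symp (fun k => expE L f₀ φ₀ t x k * invConj L k)
    (inv_symp (isUnit_solT f₀ φ₀ hL hLc t x) (blockT_symp _)) blockV_symp
  have h1 : conjM (solW L f₀ φ₀ t x) =
      1 + conjM (solK L f₀ φ₀ t x * (solT L f₀ φ₀ t x)⁻¹ * blockV N) := by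
    ext i j
    by_cases hij : i = j <;> simp [conjM, -Matrix.map_mul, solW, one_apply, hij]
  rw [h1, solW, Matrix.add_mul, Matrix.mul_add, Matrix.one_mul, Matrix.mul_one]
  exact congrArg _ h

theorem solH_entries (t x : ℝ) :
    solH L f₀ φ₀ t x (.inl ()) (.inr ()) = -star (solH L f₀ φ₀ t x (.inr ()) (.inl ())) := by
  refine (entries_of_symp ?_).2
  have hB : (blockDiag (invConj L) * blockV N) * symp Unit =
      symp (Fin N) * conjM (blockDiag (invConj L) * blockV N) := by
    rw [Matrix.mul_assoc, blockV_symp, ← Matrix.mul_assoc, blockDiag_symp, conjM_mul,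
      Matrix.mul_assoc]
  have h := moment_symp (fun k => expE L f₀ φ₀ t x k * invConj L k)
    (inv_symp (isUnit_solT f₀ φ₀ hL hLc t x) (blockT_symp _)) hB
  simp only [← Matrix.mul_assoc] at h
  exact h

theorem contDiff_solW (i j : Unit ⊕ Unit) :
    ContDiff ℝ ∞ fun p : ℝ × ℝ => solW L f₀ φ₀ p.1 p.2 i j := by
  have hT := contDiff_matrix_inv (contDiff_blockT L (contDiff_expE L f₀ φ₀))
    (fun p => isUnit_solT f₀ φ₀ hL hLc p.1 p.2)
  have hK := contDiff_blockK fun k => (contDiff_expE L f₀ φ₀ k).mul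
    (contDiff_const (c := invConj L k))
  have h := contDiff_matrix_mul (contDiff_matrix_mul hK hT)
    (fun i j => contDiff_const (c := blockV N i j)) i j
  exact contDiff_const.add h

theorem rowGamma_vecMul_matY (t x : ℝ) :
    rowGamma L ᵥ* matY L f₀ φ₀ t x = fun k => expE L f₀ φ₀ t x k * invConj L k := by
  have hu := isUnit_matC_mul_diagonal hL hLc
  have h1 : rowGamma L ᵥ* (matC L * diagonal fun k => starRingEnd ℂ (L k)) = 1 := by
    rw [rowGamma, vecMul_vecMul, nonsing_inv_mul _ ((isUnit_iff_isUnit_det _).1 hu), vecMul_one]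
  rw [← vecMul_vecMul] at h1
  rw [matY_eq, ← vecMul_vecMul]
  funext k
  have hk := congrFun h1 k
  have h0 : starRingEnd ℂ (L k) ≠ 0 := by simpa using ne_zero_of_ne_conj hLc k
  rw [vecMul_diagonal] at hk ⊢
  rw [eq_div_of_mul_eq h0 hk, invConj, Pi.one_apply, one_div, mul_comm]

/-- Block elimination expresses `T⁻¹` through `R = (1 + Y^* Y)⁻¹`, and `⟨γ|Y` is the row inside `K`.
-/
theorem nSoliton_eq (U : Matrix (Fin 2) (Fin 2) ℂ) (t x : ℝ) :
    nSoliton L f₀ φ₀ U t x = U *ᵥ ![solW L f₀ φ₀ t x (.inr ()) (.inl ()),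
      solW L f₀ φ₀ t x (.inr ()) (.inr ())] := by
  set Y := matY L f₀ φ₀ t x with hY
  set R := (1 + conjM Y * Y)⁻¹ with hR
  have hu := isUnit_one_add_conj_mul_self hL hLc (expE_ne_zero L f₀ φ₀ t x)
    (matY_eq L f₀ φ₀ t x)
  have hMR : (1 + conjM Y * Y) * R = 1 := mul_nonsing_inv _ ((isUnit_iff_isUnit_det _).1 hu)
  have hinv : (solT L f₀ φ₀ t x)⁻¹ =
      fromBlocks R (R * conjM Y) (-(Y * R)) (1 - Y * R * conjM Y) := by
    refine inv_eq_right_inv ?_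
    change fromBlocks 1 (-conjM Y) Y 1 * _ = 1
    have h1 : R + conjM Y * (Y * R) = 1 := by
      rw [← hMR, Matrix.add_mul, Matrix.one_mul, Matrix.mul_assoc]
    have h2 : R * conjM Y - conjM Y * (1 - Y * R * conjM Y) = 0 := by
      have := congrArg (· * conjM Y) h1
      simp only [Matrix.add_mul, Matrix.one_mul, Matrix.mul_assoc] at this
      simp only [Matrix.mul_sub, Matrix.mul_one, Matrix.mul_assoc]
      rw [← sub_eq_zero] at this
      rw [← this]; abel
    rw [fromBlocks_multiply, ← fromBlocks_one]
    congr 1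
    · rw [Matrix.one_mul, Matrix.neg_mul, Matrix.mul_neg, neg_neg, h1]
    · rw [Matrix.one_mul, Matrix.neg_mul, ← sub_eq_add_neg, h2]
    · rw [Matrix.one_mul, add_neg_cancel]
    · rw [Matrix.one_mul, Matrix.mul_assoc]; abel
  set q : Fin N → ℂ := fun k => expE L f₀ φ₀ t x k * invConj L k with hq
  have hγ : rowGamma L ᵥ* Y = q := rowGamma_vecMul_matY f₀ φ₀ hL hLc t x
  have hW : solW L f₀ φ₀ t x = 1 + blockK q *
      fromBlocks R (R * conjM Y) (-(Y * R)) (1 - Y * R * conjM Y) * blockV N := by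
    rw [← hinv]; rfl
  have h21 : solW L f₀ φ₀ t x (.inr ()) (.inl ()) = (q ᵥ* R) ⬝ᵥ 1 := by
    rw [hW, blockK, blockV, fromBlocks_multiply, fromBlocks_multiply]
    simp [Matrix.mul_apply, dotProduct, vecMul, one_apply]
  have h22 : solW L f₀ φ₀ t x (.inr ()) (.inr ()) = 1 + (q ᵥ* (R * conjM Y)) ⬝ᵥ 1 := by
    rw [hW, blockK, blockV, fromBlocks_multiply, fromBlocks_multiply]
    simp [Matrix.mul_apply, dotProduct, vecMul, one_apply]
  rw [nSoliton, h21, h22, matOmega, ← hY, ← hR, Matrix.mul_assoc, ← vecMul_vecMul,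
    ← vecMul_vecMul (rowGamma L) Y, hγ]

theorem contDiff_nSoliton (U : Matrix (Fin 2) (Fin 2) ℂ) :
    ContDiff ℝ ∞ (Function.uncurry (nSoliton L f₀ φ₀ U)) := by
  have e : Function.uncurry (nSoliton L f₀ φ₀ U) = fun p : ℝ × ℝ =>
      U *ᵥ ![solW L f₀ φ₀ p.1 p.2 (.inr ()) (.inl ()), solW L f₀ φ₀ p.1 p.2 (.inr ()) (.inr ())] :=
    funext fun p => nSoliton_eq f₀ φ₀ hL hLc U p.1 p.2
  rw [e, contDiff_pi]
  intro i
  simp only [mulVec, dotProduct, Fin.sum_univ_two, Matrix.cons_val_zero, Matrix.cons_val_one]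
  exact (contDiff_const.mul (contDiff_solW f₀ φ₀ hL hLc _ _)).add
    (contDiff_const.mul (contDiff_solW f₀ φ₀ hL hLc _ _))

/-- A row of `solW`. -/
def solRow (L : Fin N → ℂ) (f₀ φ₀ : Fin N → ℝ) (i : Unit ⊕ Unit) (t x : ℝ) : Fin 2 → ℂ :=
  ![solW L f₀ φ₀ t x i (.inl ()), solW L f₀ φ₀ t x i (.inr ())]

/-- With the quaternionic form of `W`, the determinant is the squared norm of the second row. -/
theorem normSq_solW (t x : ℝ) :
    solW L f₀ φ₀ t x (.inr ()) (.inl ()) * star (solW L f₀ φ₀ t x (.inr ()) (.inl ())) +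
    solW L f₀ φ₀ t x (.inr ()) (.inr ()) * star (solW L f₀ φ₀ t x (.inr ()) (.inr ())) = 1 := by
  have hd := det_solW f₀ φ₀ hL hLc t x
  obtain ⟨h1, h2⟩ := solW_entries f₀ φ₀ hL hLc t x
  let g : Fin 2 ≃ Unit ⊕ Unit :=
    { toFun := ![.inl (), .inr ()]
      invFun := Sum.elim (fun _ => 0) (fun _ => 1)
      left_inv := by intro i; fin_cases i <;> rfl
      right_inv := by rintro (⟨⟩ | ⟨⟩) <;> rfl }
  rw [← det_submatrix_equiv_self g, det_fin_two] at hd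
  change solW L f₀ φ₀ t x (.inl ()) (.inl ()) * solW L f₀ φ₀ t x (.inr ()) (.inr ()) -
    solW L f₀ φ₀ t x (.inl ()) (.inr ()) * solW L f₀ φ₀ t x (.inr ()) (.inl ()) = 1 at hd
  rw [h1, h2] at hd
  linear_combination hd

theorem solves_nSoliton {U : Matrix (Fin 2) (Fin 2) ℂ} (hU : U ∈ Matrix.unitaryGroup (Fin 2) ℂ) :
    SolvesConstrained (nSoliton L f₀ φ₀ U) ∧ SolvesGradientNLSE (nSoliton L f₀ φ₀ U) := by
  have e : nSoliton L f₀ φ₀ U = fun t x => U *ᵥ solRow L f₀ φ₀ (.inr ()) t x :=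
    funext fun t => funext fun x => nSoliton_eq f₀ φ₀ hL hLc U t x
  rw [e]
  -- The companion is the first row of `W`, the potential the lower left entry of `H`.
  refine solves_of_akns (φ := fun t x => U *ᵥ solRow L f₀ φ₀ (.inl ()) t x)
    (h := fun t x => solH L f₀ φ₀ t x (.inr ()) (.inl ()))
    (h' := fun t x => solHx L f₀ φ₀ t x (.inr ()) (.inl ())) ?_ ?_ ?_ ?_ ?_ ?_ ?_ <;> intro t x
  · rw [star_mulVec_dotProduct hU]
    have h := normSq_solW f₀ φ₀ hL hLc t x
    simp only [solRow, dotProduct, Fin.sum_univ_two, Pi.star_apply, Matrix.cons_val_zero,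
      Matrix.cons_val_one]
    linear_combination h
  · rw [star_mulVec_dotProduct hU]
    have h := normSq_solW f₀ φ₀ hL hLc t x
    obtain ⟨h1, h2⟩ := solW_entries f₀ φ₀ hL hLc t x
    simp only [solRow, dotProduct, Fin.sum_univ_two, Pi.star_apply, Matrix.cons_val_zero,
      Matrix.cons_val_one, h1, h2, star_neg, star_star]
    linear_combination h
  · rw [star_mulVec_dotProduct hU]
    obtain ⟨h1, h2⟩ := solW_entries f₀ φ₀ hL hLc t x
    simp only [solRow, dotProduct, Fin.sum_univ_two, Pi.star_apply, Matrix.cons_val_zero,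
      Matrix.cons_val_one, h1, h2]
    ring
  · rw [← mulVec_smul]
    refine hasDerivAt_mulVec U ((hasDerivAt_row
      (hasMatDerivAt_solW_x f₀ φ₀ hL hLc t x) (.inr ())).congr_deriv ?_)
    funext j
    fin_cases j <;>
    · simp [solRow, Matrix.mul_apply, signs]
      ring
  · rw [← mulVec_smul]
    have hh := solH_entries f₀ φ₀ hL hLc t x
    refine hasDerivAt_mulVec U ((hasDerivAt_row
      (hasMatDerivAt_solW_x f₀ φ₀ hL hLc t x) (.inl ())).congr_deriv ?_)
    funext j
    fin_cases j <;>
    · simp [solRow, Matrix.mul_apply, signs, hh]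
      ring
  · rw [← mulVec_smul, ← mulVec_smul, ← mulVec_add]
    have hh := solH_entries f₀ φ₀ hL hLc t x
    have hx := solHx_inr_inr f₀ φ₀ hL hLc t x
    rw [hh] at hx
    refine hasDerivAt_mulVec U ((hasDerivAt_row
      (hasMatDerivAt_solW_t f₀ φ₀ hL hLc t x) (.inr ())).congr_deriv ?_)
    funext j
    fin_cases j <;>
    · simp [solRow, Matrix.mul_apply, hx]
  · exact hasMatDerivAt_solH_x f₀ φ₀ hL hLc t x (.inr ()) (.inl ())

end Dressed

end ConstrainedNLSE

end

theorem proposition4p1 (N : ℕ) (L : Fin N → ℂ) (hL : Function.Injective L)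
    (hLc : ∀ j k, L j ≠ starRingEnd ℂ (L k)) (f₀ φ₀ : Fin N → ℝ)
    (U : Matrix (Fin 2) (Fin 2) ℂ) (hU : U ∈ Matrix.unitaryGroup (Fin 2) ℂ) :
    -- all the inverses in the definition of the soliton exist
    IsUnit (ConstrainedNLSE.matC L * Matrix.diagonal fun k => starRingEnd ℂ (L k)) ∧
    (∀ t x : ℝ, IsUnit (1 + ConstrainedNLSE.conjM (ConstrainedNLSE.matY L f₀ φ₀ t x) *
      ConstrainedNLSE.matY L f₀ φ₀ t x)) ∧
    -- the soliton is smooth, and solves the constrained system and the gradient NLSE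
    ContDiff ℝ ∞ (Function.uncurry (ConstrainedNLSE.nSoliton L f₀ φ₀ U)) ∧
    ConstrainedNLSE.SolvesConstrained (ConstrainedNLSE.nSoliton L f₀ φ₀ U) ∧
    ConstrainedNLSE.SolvesGradientNLSE (ConstrainedNLSE.nSoliton L f₀ φ₀ U) :=
  ⟨ConstrainedNLSE.isUnit_matC_mul_diagonal hL hLc,
    fun t x => ConstrainedNLSE.isUnit_one_add_conj_mul_self hL hLc
      (ConstrainedNLSE.expE_ne_zero L f₀ φ₀ t x) (ConstrainedNLSE.matY_eq L f₀ φ₀ t x),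
    ConstrainedNLSE.contDiff_nSoliton f₀ φ₀ hL hLc U,
    ConstrainedNLSE.solves_nSoliton f₀ φ₀ hL hLc hU⟩
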